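/- **Setting.** A schema has one entity class $E$ (nodes) and one relationship class $R$ (pairs of nodes), finitely many real-valued attributes of nodes and of pairs, among them a binary treatment $X$ and an outcome $Y$ (node attributes) and a binary edge indicator $\mathrm{Exists}$ (pair attribute). Some attributes are latent (never measured); $X$ and $Y$ are not. On a finite node set $V$ the relationship instances are all unordered pairs of distinct nodes. A network structural causal model (NSCM) consists of relational dependencies whose class dependency graph is acyclic (each relationship attribute other than $\mathrm{Exists}$ also depends on $\mathrm{Exists}$ and has a default value where there is no edge) and of measurable mechanisms $v=f_v(\mathrm{pa}(v),\epsilon_v)$, where $v$ runs over the attributes of nodes and pairs, $\mathrm{pa}(v)$ are its parents in the ground graph, and $\epsilon$ is exogenous noise. Counterfactuals are obtained by replacing treatment mechanisms by constants: $Y_i(X_i=b)$ sets only $X_i=b$, and $Y_i(X_i=b,X_{-i}=\pi_{-i})$ sets all treatments. For a node $i$, $X_{-i}$ denotes the treatments of all other nodes, and $\mathcal Z_i=\{Z_i,Z_r,Z_{-i},Z_{-r},E_r,E_{-r}\}$ all measured attributes other than $X,Y$ (including $\mathrm{Exists}$) of $i$, of the pairs containing $i$, of the other nodes, and of the remaining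 pairs. **Assumption A1** (the network and its attributes are measured before treatment, and treatments are immutable until outcome measurement). $\mathrm{Exists}$ is measured; no measured attribute other than $X,Y$ is a descendant of $X$ or $Y$; the set of selection attributes consists of the measured attributes other than $X,Y$ (so there is no selection on $X$ or $Y$); time-lagged attributes are latent; and time-lagged treatments are not direct causes of $Y$. **Data.** *Experimental data*: the treatment vector has an arbitrary joint law on $\{0,1\}^V$ (the design), is independent of all exogenous noise, and replaces the treatment mechanisms. *Observational data*: treatments follow their own mechanisms, and it is assumed that the unconfoundedness condition $\{Y_i(X_i=1),Y_i(X_i=0)\}\perp\!\!\!\perp X_i\mid\mathbf W$ holds for some adjustment set $\mathbf W$, i.e. a set of measured relational variables of $i$ that contains $X_{-i}$ and all selection variables, but neither $X_i$ nor outcomes. **Corollary.** Let an NSCM satisfy A1, let $i\in V$, take either experimental data, or observational data with the above condition, and let $Y_i(X_i=0),Y_i(X_i=1)$ be integrable. Let $Q$ be the law of the measured data. 1. For each $b\in\{0,1\}$, almost surely on the event $Q(X_i=b\mid X_{-i},\mathcal Z_i)>0$, $$E[Y_i(X_i=b)\mid X_{-i},\mathcal Z_i]=E_Q[Y_i\mid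 X_i=b,X_{-i},\mathcal Z_i],$$ where the right-hand side is computed from $Q$ alone. 2. The individual direct effect is therefore identified: for every $\pi\in\{0,1\}^V$, almost surely on the event that $X_{-i}=\pi_{-i}$ and $0<Q(X_i=1\mid X_{-i},\mathcal Z_i)<1$, $$E\big[Y_i(X_i=1,X_{-i}=\pi_{-i})-Y_i(X_i=0,X_{-i}=\pi_{-i})\mid X_{-i}=\pi_{-i},\mathcal Z_i\big]=E_Q[Y_i\mid X_i=1,X_{-i},\mathcal Z_i]-E_Q[Y_i\mid X_i=0,X_{-i},\mathcal Z_i].$$ -/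

import Mathlib

open MeasureTheory ProbabilityTheory

noncomputable section

namespace NetCausal

/-! ### Relational schema, skeleton, relational paths -/

/-- The two item classes of a single-entity, single-relationship schema. -/
inductive ItemClass
  | entity
  | relationship

/-- The item class that follows `c` on a relational path. -/
def ItemClass.other : ItemClass → ItemClass
  | .entity => .relationship
  | .relationship => .entity

/-- A relational path alternates between the two classes, so it is given by its base class and its
number of steps; this is its terminal class. -/
def termClass (c : ItemClass) (steps : ℕ) : ItemClass := ItemClass.other^[steps] c

/-- A relational schema with a treatment attribute, an outcome attribute and a relationship
existence indicator. Some attributes are marked as latent, some as selection attributes, and some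
as time-lagged versions of other attributes. -/
structure Schema where
  /-- all (entity and relationship) attributes -/
  A : Type
  finite_A : Finite A
  cls : A → ItemClass
  /-- treatment -/
  X : A
  /-- outcome -/
  Y : A
  /-- relationship existence indicator -/
  Ex : A
  X_ne_Y : X ≠ Y
  cls_X : cls X = .entity
  cls_Y : cls Y = .entity
  cls_Ex : cls Ex = .relationship
  /-- attributes that are never measured -/
  latent : Set A
  X_observed : X ∉ latent
  Y_observed : Y ∉ latent
  /-- attributes responsible for selection -/
  selection : Set A
  /-- `lagged a` is the set of time-lagged versions of the attribute `a` -/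
  lagged : A → Set A
  cls_lagged : ∀ a, ∀ b ∈ lagged a, cls b = cls a
  /-- value of a relationship attribute on a pair of nodes that is not an edge of the network -/
  default : A → ℝ

attribute [instance] Schema.finite_A

/-- Observed covariates: the measured node and edge attributes (including the existence indicator)
other than treatment and outcome. -/
def Schema.background (S : Schema) : Set S.A := {a | a ∉ S.latent ∧ a ≠ S.X ∧ a ≠ S.Y}

/-- Items of the skeleton on the node set `V`: the nodes, and as relationship instances all
unordered pairs of distinct nodes (the edges of the complete graph). -/
abbrev Item (V : Type) : Type := V ⊕ {e : Sym2 V // ¬ e.IsDiag}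

def Item.cls {V : Type} : Item V → ItemClass
  | .inl _ => .entity
  | .inr _ => .relationship

/-- A node is incident to the pairs that contain it, and vice versa. -/
def Incident {V : Type} : Item V → Item V → Prop
  | .inl v, .inr e => v ∈ e.1
  | .inr e, .inl v => v ∈ e.1
  | _, _ => False

/-- Items visited by a breadth-first traversal from `b` up to depth `n`. -/
def visited {V : Type} (b : Item V) : ℕ → Set (Item V)
  | 0 => {b}
  | n + 1 => visited b n ∪ {x | ∃ y ∈ visited b n, Incident x y}

/-- Terminal set of the relational path with `n` steps from the base item `b` under bridge burning
semantics: the items that the traversal meets for the first time at depth `n`. -/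
def terminal {V : Type} (b : Item V) : ℕ → Set (Item V)
  | 0 => {b}
  | n + 1 => visited b (n + 1) \ visited b n

/-- A relational dependency `P.cause → [I].effect`, where `I` is the class of `effect` and `P` is
the relational path with base class `I` and `steps` steps. -/
structure Dependency (S : Schema) where
  steps : ℕ
  cause : S.A
  effect : S.A
  cls_cause : S.cls cause = termClass (S.cls effect) steps

/-- The implicit dependencies `[R].Exists → [R].a` for the other relationship attributes `a`. -/
def implicitDeps (S : Schema) : Set (Dependency S) :=
  {d | d.steps = 0 ∧ d.cause = S.Ex ∧ d.effect ≠ S.Ex}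

/-- Edges of the class dependency graph. -/
def ClassEdge {S : Schema} (D : Set (Dependency S)) (a b : S.A) : Prop :=
  ∃ d ∈ D ∪ implicitDeps S, d.cause = a ∧ d.effect = b

/-- Vertices of the ground graph: attributes of items. -/
structure GVar (S : Schema) (V : Type) where
  attr : S.A
  item : Item V
  cls_item : item.cls = S.cls attr

/-- Edges of the ground graph. -/
def GroundEdge {S : Schema} (V : Type) (D : Set (Dependency S)) (u v : GVar S V) : Prop :=
  ∃ d ∈ D ∪ implicitDeps S, d.cause = u.attr ∧ d.effect = v.attr ∧ u.item ∈ terminal v.item d.steps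

/-! ### Network structural causal models -/

/-- An acyclic network structural causal model, realized on the node set `V`. The mechanism of a
ground variable is a measurable function of its parents in the ground graph and of an exogenous
noise. (Mechanisms that all items of a class share, and independent noises, are special cases.) -/
structure NSCM (S : Schema) (V : Type) where
  /-- explicit relational dependencies -/
  D : Set (Dependency S)
  acyclic : ∀ a, ¬ Relation.TransGen (ClassEdge D) a a
  f : (v : GVar S V) → ({u : GVar S V // GroundEdge V D u v} → ℝ) → ℝ → ℝ
  f_meas : ∀ v, Measurable
    (fun p : ({u : GVar S V // GroundEdge V D u v} → ℝ) × ℝ => f v p.1 p.2)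
  /-- treatments and existence indicators are binary -/
  f_binary : ∀ v, (v.attr = S.X ∨ v.attr = S.Ex) → ∀ pa e, f v pa e = 0 ∨ f v pa e = 1
  /-- the other relationship attributes take their default value where there is no edge -/
  f_default : ∀ v, S.cls v.attr = .relationship → v.attr ≠ S.Ex → ∀ pa e,
    (∀ u, u.1.attr = S.Ex → u.1.item = v.item → pa u = 0) → f v pa e = S.default v.attr
  /-- law of the exogenous noise -/
  noise : Measure (GVar S V → ℝ)
  noise_prob : IsProbabilityMeasure noise

attribute [instance] NSCM.noise_prob

instance GVar.instFinite (S : Schema) (V : Type) [Finite V] : Finite (GVar S V) := by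
  have : Finite (Sym2 V) := Quot.finite _
  refine Finite.of_injective (fun v : GVar S V => (v.attr, v.item)) ?_
  rintro ⟨a, i, h⟩ ⟨b, j, k⟩ e
  simp only [Prod.mk.injEq] at e
  obtain ⟨rfl, rfl⟩ := e
  rfl

variable {S : Schema} {V : Type}

theorem NSCM.wf (M : NSCM S V) : WellFounded (GroundEdge V M.D) := by
  have : Std.Irrefl (Relation.TransGen (ClassEdge M.D)) := ⟨M.acyclic⟩
  have h : WellFounded (Relation.TransGen (ClassEdge M.D)) :=
    Finite.wellFounded_of_trans_of_irrefl _
  refine Subrelation.wf ?_ (InvImage.wf (fun v : GVar S V => v.attr) h)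
  rintro u v ⟨d, hd, h1, h2, -⟩
  exact Relation.TransGen.single ⟨d, hd, h1, h2⟩

/-- The treatment levels as real numbers. -/
def level (b : Bool) : ℝ := if b then 1 else 0

open Classical in
/-- The value that the intervention `x` forces on a ground variable: `x j = some b` means that the
treatment of node `j` is set to `b`, and `x j = none` that it is left alone. -/
def doValue (x : V → Option Bool) (v : GVar S V) : Option ℝ :=
  if v.attr = S.X then
    match v.item with
    | .inl j => (x j).map level
    | .inr _ => none
  else none

/-- The solution of the structural equations under the intervention `x` on treatments, for the
noise `e`. -/
def NSCM.solve (M : NSCM S V) (x : V → Option Bool) (e : GVar S V → ℝ) : GVar S V → ℝ :=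
  M.wf.fix fun v ih =>
    match doValue x v with
    | some r => r
    | none => M.f v (fun u => ih u.1 u.2) (e v)

theorem NSCM.solve_eq (M : NSCM S V) (x : V → Option Bool) (e : GVar S V → ℝ) (v : GVar S V) :
    M.solve x e v = match doValue x v with
      | some r => r
      | none => M.f v (fun u => M.solve x e u.1) (e v) :=
  M.wf.fix_eq _ v

theorem NSCM.measurable_solve (M : NSCM S V) (x : V → Option Bool) :
    Measurable (M.solve x) := by
  refine measurable_pi_iff.2 fun v => ?_
  induction v using M.wf.induction with
  | _ v ih =>
    simp_rw [M.solve_eq x _ v]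
    cases doValue x v with
    | some r => exact measurable_const
    | none =>
      exact (M.f_meas v).comp
        ((measurable_pi_iff.2 fun u => ih u.1 u.2).prodMk (measurable_pi_apply v))

/-- The formal content of the assumption that the network and its attributes are measured before
treatment assignment and that treatments are immutable from assignment to outcome measurement. -/
structure NSCM.PreTreatment (M : NSCM S V) : Prop where
  /-- the network is measured -/
  network_observed : S.Ex ∉ S.latent
  /-- observed node and edge attributes are not descendants of treatment or outcome -/
  not_desc_X : ∀ a ∈ S.background, ¬ Relation.TransGen (ClassEdge M.D) S.X a
  not_desc_Y : ∀ a ∈ S.background, ¬ Relation.TransGen (ClassEdge M.D) S.Y a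
  /-- there is no selection on treatment or outcome: the population is selected on the observed
  covariates -/
  selection_eq : S.selection = S.background
  /-- time-lagged attributes are latent -/
  lagged_latent : ∀ a, S.lagged a ⊆ S.latent
  /-- time-lagged treatments do not directly affect the outcome -/
  immutable : ∀ d ∈ M.D, d.effect = S.Y → d.cause ∉ S.lagged S.X

/-! ### Relational variables of a node and measured data -/

/-- A relational variable from the entity perspective: one of the four relational paths `[E]`,
`[E,R]`, `[E,R,E]`, `[E,R,E,R]`, and an attribute of its terminal class. -/
structure RelVar (S : Schema) where
  steps : Fin 4
  attr : S.A
  cls_attr : S.cls attr = termClass .entity steps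

/-- The ground variables that make up a set of relational variables for the node `i`. -/
def ground (W : Set (RelVar S)) (i : V) : Set (GVar S V) :=
  {v | ∃ r ∈ W, r.attr = v.attr ∧ v.item ∈ terminal (.inl i) r.steps}

/-- The treatment `[E].X` of the node itself. -/
def ownTreatment (S : Schema) : RelVar S := ⟨0, S.X, S.cls_X⟩

/-- The treatments `[E,R,E].X` of all other nodes. -/
def peerTreatment (S : Schema) : RelVar S := ⟨2, S.X, S.cls_X⟩

/-- The contexts: all relational variables of observed covariates (own, own relationships, other
nodes, relationships between other nodes). -/
def contexts (S : Schema) : Set (RelVar S) := {r | r.attr ∈ S.background}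

/-- The maximal adjustment set: peer treatments and contexts. -/
def maximalSet (S : Schema) : Set (RelVar S) := insert (peerTreatment S) (contexts S)

/-- Adjustment sets for the effect of a node's own treatment on its outcome: sets of measured
relational variables that contain the peer treatments and all selection variables, but neither the
node's own treatment nor an outcome. -/
structure IsAdjustmentSet (W : Set (RelVar S)) : Prop where
  peer_mem : peerTreatment S ∈ W
  measured : ∀ r ∈ W, r.attr ∉ S.latent
  selection_subset : ∀ r : RelVar S, r.attr ∈ S.selection → r ∈ W
  own_notMem : ownTreatment S ∉ W
  outcome_notMem : ∀ r ∈ W, r.attr ≠ S.Y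

/-- One data record: the values of all measured ground variables. -/
abbrev Record (S : Schema) (V : Type) : Type := {v : GVar S V // v.attr ∉ S.latent} → ℝ

def Record.treatment (o : Record S V) (j : V) : ℝ := o ⟨⟨S.X, .inl j, S.cls_X.symm⟩, S.X_observed⟩

def Record.outcome (o : Record S V) (j : V) : ℝ := o ⟨⟨S.Y, .inl j, S.cls_Y.symm⟩, S.Y_observed⟩

/-- The σ-algebra on records generated by the measured relational variables in `W` for node `i`. -/
abbrev Record.sigma (W : Set (RelVar S)) (i : V) : MeasurableSpace (Record S V) :=
  MeasurableSpace.comap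
    (fun (o : Record S V) (v : {v : {v : GVar S V // v.attr ∉ S.latent} // v.1 ∈ ground W i}) =>
      o v.1)
    inferInstance

/-- `E[Y_i | X_i = b, X_{-i}, Z_i]` for the law `Q` of the measured data: the conditional
expectation given peer treatments and contexts, under `Q` conditioned on `X_i = b`. -/
def regression (Q : Measure (Record S V)) (i : V) (b : Bool) : Record S V → ℝ :=
  (Q[|{o | o.treatment i = level b}])[fun o => o.outcome i | Record.sigma (maximalSet S) i]

/-- `P(X_i = b | X_{-i}, Z_i)` for the law `Q` of the measured data. -/
def propensity (Q : Measure (Record S V)) (i : V) (b : Bool) : Record S V → ℝ :=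
  Q[{o | o.treatment i = level b}.indicator (fun _ => (1 : ℝ)) | Record.sigma (maximalSet S) i]

/-! ### Observational and experimental data, counterfactuals -/

/-- A data-generating regime: a probability space and, for every intervention on treatments, the
values of all ground variables in the world with that intervention. -/
structure Regime (S : Schema) (V : Type) where
  Ω : Type
  mΩ : MeasurableSpace Ω
  P : Measure Ω
  world : (V → Option Bool) → Ω → GVar S V → ℝ

attribute [instance] Regime.mΩ

/-- Observational data: treatments follow their own mechanisms unless intervened upon. -/
def NSCM.observational (M : NSCM S V) : Regime S V where
  Ω := GVar S V → ℝ
  mΩ := inferInstance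
  P := M.noise
  world := M.solve

/-- Experimental data: the treatment vector is drawn from a design `ρ` (a joint law, so treatments
of different nodes may be correlated), independently of all exogenous noise, and replaces the
treatment mechanisms; a further intervention overrides the assigned treatments. -/
def NSCM.experimental (M : NSCM S V) (ρ : Measure (V → Bool)) : Regime S V where
  Ω := (V → Bool) × (GVar S V → ℝ)
  mΩ := inferInstance
  P := ρ.prod M.noise
  world := fun x ω => M.solve (fun j => some ((x j).getD (ω.1 j))) ω.2

namespace Regime

/-- The measured data: the factual values of the measured variables. -/
def record (R : Regime S V) (ω : R.Ω) : Record S V := fun v => R.world (fun _ => none) ω v.1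

/-- The law of the measured data. -/
def law (R : Regime S V) : Measure (Record S V) := R.P.map R.record

/-- The σ-algebra generated by the factual values of the relational variables in `W`. -/
abbrev sigma (R : Regime S V) (W : Set (RelVar S)) (i : V) : MeasurableSpace R.Ω :=
  (Record.sigma W i).comap R.record

/-- The outcome of node `i` in the world with intervention `x`. -/
def outcome (R : Regime S V) (x : V → Option Bool) (i : V) (ω : R.Ω) : ℝ :=
  R.world x ω ⟨S.Y, .inl i, S.cls_Y.symm⟩

variable [DecidableEq V]

/-- The counterfactual outcome `Y_i(X_i = b)`: only the treatment of `i` is set. -/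
def counterfactual (R : Regime S V) (i : V) (b : Bool) : R.Ω → ℝ :=
  R.outcome (fun j => if j = i then some b else none) i

/-- The counterfactual outcome `Y_i(X_i = b, X_{-i} = π_{-i})`: all treatments are set. -/
def jointCounterfactual (R : Regime S V) (i : V) (b : Bool) (π : V → Bool) : R.Ω → ℝ :=
  R.outcome (fun j => if j = i then some b else some (π j)) i

/-- The individual direct effect
`E[Y_i(X_i = 1, X_{-i} = π_{-i}) - Y_i(X_i = 0, X_{-i} = π_{-i}) | X_{-i} = π_{-i}, Z_i]`. -/
def directEffect (R : Regime S V) (i : V) (π : V → Bool) : R.Ω → ℝ :=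
  (R.P[|{ω | ∀ j, j ≠ i → (R.record ω).treatment j = level (π j)}])[
    fun ω => R.jointCounterfactual i true π ω - R.jointCounterfactual i false π ω
    | R.sigma (contexts S) i]

end Regime

theorem NSCM.measurable_record (M : NSCM S V) : Measurable M.observational.record :=
  measurable_pi_iff.2 fun v => (measurable_pi_apply v.1).comp (M.measurable_solve fun _ => none)

theorem NSCM.sigma_le (M : NSCM S V) (W : Set (RelVar S)) (i : V) :
    M.observational.sigma W i ≤ M.observational.mΩ := by
  refine le_trans (MeasurableSpace.comap_mono ?_) M.measurable_record.comap_le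
  exact Measurable.comap_le (measurable_pi_iff.2 fun v => measurable_pi_apply v.1)

instance NSCM.instStandardBorelSpace [Finite V] (M : NSCM S V) :
    StandardBorelSpace M.observational.Ω :=
  inferInstanceAs (StandardBorelSpace (GVar S V → ℝ))

instance NSCM.instIsProbabilityMeasure (M : NSCM S V) : IsProbabilityMeasure M.observational.P :=
  M.noise_prob

/-- The unconfoundedness condition: the pair `Y_i(X_i = 1), Y_i(X_i = 0)` is conditionally
independent of `X_i` given `W`, in observational data. -/
def NSCM.Unconfounded [Finite V] [DecidableEq V] (M : NSCM S V) (i : V) (W : Set (RelVar S)) :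
    Prop :=
  CondIndepFun (M.observational.sigma W i) (M.sigma_le W i)
    (fun ω => (M.observational.counterfactual i true ω, M.observational.counterfactual i false ω))
    (fun ω => (M.observational.record ω).treatment i) M.observational.P

end NetCausal

end

open NetCausal

/-! Write σ for the information in peer treatments and contexts, B for the event X_i = b, and f for
Y_i(X_i = b). Everything rests on the product rule E[1_B f | σ] = E[f | σ] · P(B | σ). By
consistency 1_B f = 1_B Y_i, and Bayes' formula turns E[1_B Y_i | σ] into the regression times P(B |
σ). Where the propensity is positive it cancels, which gives the first claim
(`condExp_eq_cond_condExp_of_condExp_mul`).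

The two kinds of data differ in the source of the product rule. For observational data it is
unconfoundedness: since selection acts on exactly the observed covariates, the only possible
adjustment set is the maximal one (`IsAdjustmentSet.eq_maximalSet`). For experimental data it is
Fubini: with the peer assignment fixed, contexts and counterfactual are functions of the noise
alone, which is independent of the assignment (`condExp_prod_indicator_eq_mul_of_slice`).

For the direct effect, let A be the event X_{-i} = π_{-i}. On A the joint counterfactual equals
Y_i(X_i = b), because setting X_i does not change the other treatments. Also on A the contexts
determine all of σ, so conditioning on A and then on contexts is conditioning on σ
(`cond_condExp_ae_eq_of_comap`). Linearity and the first claim finish the proof. -/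

namespace MeasureTheory

/-! ### Conditional expectations under images, conditioning and products -/

variable {Ω Ω' 𝓣 : Type*} {m : MeasurableSpace Ω} {σ : MeasurableSpace Ω'}
  [mΩ : MeasurableSpace Ω] [mΩ' : MeasurableSpace Ω']
  [m𝓣 : MeasurableSpace 𝓣]

/-- Change of variables for conditional expectations. -/
theorem condExp_map_comp_ae_eq {μ : Measure Ω} [IsFiniteMeasure μ] {T : Ω → Ω'} (hT : Measurable T)
    (hσ : σ ≤ mΩ') {y : Ω' → ℝ} (hy : Integrable y (μ.map T)) :
    (fun ω => ((μ.map T)[y | σ]) (T ω)) =ᵐ[μ] μ[fun ω => y (T ω) | σ.comap T] := by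
  have hm : σ.comap T ≤ mΩ := (MeasurableSpace.comap_mono hσ).trans hT.comap_le
  have hi : Integrable ((μ.map T)[y | σ]) (μ.map T) := integrable_condExp
  refine ae_eq_condExp_of_forall_setIntegral_eq hm (hy.comp_measurable hT)
    (fun s _ _ => (hi.comp_measurable hT).integrableOn) ?_ ?_
  · rintro s ⟨t, ht, rfl⟩ -
    rw [← setIntegral_map (hσ t ht) hi.aestronglyMeasurable hT.aemeasurable,
      ← setIntegral_map (hσ t ht) hy.aestronglyMeasurable hT.aemeasurable,
      setIntegral_condExp hσ hy ht]
  · exact (stronglyMeasurable_condExp.comp_measurable (comap_measurable T)).aestronglyMeasurable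

theorem restrict_eq_smul_cond (μ : Measure Ω) [IsFiniteMeasure μ] (B : Set Ω) :
    μ.restrict B = μ B • μ[|B] := by
  by_cases h : μ B = 0
  · simp [h, Measure.restrict_eq_zero.2 h]
  · rw [ProbabilityTheory.cond, smul_smul, ENNReal.mul_inv_cancel h (measure_ne_top _ _), one_smul]

theorem IntegrableOn.integrable_cond {μ : Measure Ω} {B : Set Ω} {f : Ω → ℝ}
    (h : IntegrableOn f B μ) : Integrable f (μ[|B]) := by
  by_cases h0 : μ B = 0
  · simp [cond_eq_zero_of_meas_eq_zero h0]
  · exact Integrable.smul_measure h (ENNReal.inv_ne_top.2 h0)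

theorem Integrable.integrableOn_of_cond {μ : Measure Ω} [IsFiniteMeasure μ] {B : Set Ω} {f : Ω → ℝ}
    (h : Integrable f (μ[|B])) : IntegrableOn f B μ := by
  rw [IntegrableOn, restrict_eq_smul_cond]
  exact h.smul_measure (measure_ne_top _ _)

theorem setIntegral_indicator_eq_cond {μ : Measure Ω} [IsFiniteMeasure μ] {B C : Set Ω}
    (hB : MeasurableSet B) (hC : MeasurableSet C) (f : Ω → ℝ) :
    ∫ x in C, B.indicator f x ∂μ = μ.real B * ∫ x in C, f x ∂(μ[|B]) := by
  rw [setIntegral_indicator hB, Set.inter_comm, Set.inter_comm, ← Measure.restrict_restrict hC,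
    restrict_eq_smul_cond μ B, Measure.restrict_smul, integral_smul_measure]
  rfl

/-- Bayes' formula: conditional expectations under the conditioned measure `Q[|B]`. -/
theorem condExp_indicator_ae_eq_cond_mul {Q : Measure Ω} [IsFiniteMeasure Q]
    (hm : m ≤ mΩ) {B : Set Ω} (hB : MeasurableSet B) {y : Ω → ℝ} (hy : IntegrableOn y B Q) :
    Q[B.indicator y | m] =ᵐ[Q]
      (Q[|B])[y | m] * Q[B.indicator (fun _ => (1 : ℝ)) | m] := by
  set r := (Q[|B])[y | m] with hr
  have hri : IntegrableOn r B Q := integrable_condExp.integrableOn_of_cond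
  have hmul : r * B.indicator (fun _ => (1 : ℝ)) = B.indicator r := by
    ext x; by_cases hx : x ∈ B <;> simp [hx]
  have hrB : Integrable (B.indicator r) Q := (integrable_indicator_iff hB).2 hri
  -- As r is m-measurable it can be pulled out of E[r · 1_B | m]. It remains to see that 1_B r and
  -- 1_B y have the same conditional expectation: on sets of m both integrate to Q(B) times an
  -- integral under Q[|B], where r and y agree by the definition of r.
  refine Filter.EventuallyEq.trans ?_ (condExp_mul_of_stronglyMeasurable_left
    stronglyMeasurable_condExp (hmul ▸ hrB) ((integrable_const 1).indicator hB))
  simp only [hmul]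
  refine (ae_eq_condExp_of_forall_setIntegral_eq hm ((integrable_indicator_iff hB).2 hy)
    (fun _ _ _ => integrable_condExp.integrableOn) (fun C hC _ => ?_)
    stronglyMeasurable_condExp.aestronglyMeasurable).symm
  rw [setIntegral_condExp hm hrB hC, setIntegral_indicator_eq_cond hB (hm C hC),
    setIntegral_indicator_eq_cond hB (hm C hC), hr, setIntegral_condExp hm hy.integrable_cond hC]

/-- If `f` agrees with `y ∘ T` when `T` is in `B`, and the event `T ∈ B` is conditionally
uncorrelated with `f`, then the conditional mean of `f` is the regression of `y` on the part of the
data where `B` holds. -/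
theorem condExp_eq_cond_condExp_of_condExp_mul {P : Measure Ω} [IsFiniteMeasure P] {T : Ω → Ω'}
    (hT : Measurable T) (hσ : σ ≤ mΩ') {B : Set Ω'}
    (hB : MeasurableSet B) {y : Ω' → ℝ} (hym : Measurable y) {f : Ω → ℝ} (hf : Integrable f P)
    (hcons : ∀ ω, T ω ∈ B → f ω = y (T ω))
    (hmul : P[(T ⁻¹' B).indicator f | σ.comap T] =ᵐ[P]
      P[f | σ.comap T] * P[(T ⁻¹' B).indicator (fun _ => (1 : ℝ)) | σ.comap T]) :
    ∀ᵐ ω ∂P, 0 < ((P.map T)[B.indicator (fun _ => (1 : ℝ)) | σ]) (T ω) →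
      (P[f | σ.comap T]) ω = (((P.map T)[|B])[y | σ]) (T ω) := by
  have hind : (T ⁻¹' B).indicator f = fun ω => B.indicator y (T ω) := by
    ext ω
    by_cases h : T ω ∈ B
    · simp [h, hcons ω h]
    · simp [h]
  have hBy : Integrable (B.indicator y) (P.map T) := by
    rw [integrable_map_measure (hym.indicator hB).aestronglyMeasurable hT.aemeasurable]
    have := hf.indicator (hT hB)
    rwa [hind] at this
  have h1 := condExp_map_comp_ae_eq hT hσ hBy
  have h2 := condExp_map_comp_ae_eq (y := B.indicator (fun _ => (1 : ℝ))) (μ := P) hT hσ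
    ((integrable_const 1).indicator hB)
  have h3 := ae_of_ae_map hT.aemeasurable
    (condExp_indicator_ae_eq_cond_mul hσ hB ((integrable_indicator_iff hB).1 hBy))
  rw [hind] at hmul
  filter_upwards [h1, h2, h3, hmul] with ω h1 h2 h3 h4 hpos
  rw [h3] at h1
  have h2' : (P[(T ⁻¹' B).indicator (fun _ => (1 : ℝ)) | σ.comap T]) ω =
      ((P.map T)[B.indicator (fun _ => (1 : ℝ)) | σ]) (T ω) := h2.symm
  rw [h4, Pi.mul_apply, Pi.mul_apply, h2'] at h1
  -- Both sides carry the factor P(B | σ), which is positive here.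
  exact (mul_right_cancel₀ hpos.ne' h1).symm

/-- Conditioning on an event `A` on which the finer information `T₂` is a function of the coarser
information `T₁`. -/
theorem cond_condExp_ae_eq_of_comap {P : Measure Ω} [IsFiniteMeasure P] {T₁ : Ω → Ω'} {T₂ : Ω → 𝓣}
    (h12 : m𝓣.comap T₂ ≤ mΩ) (h : mΩ'.comap T₁ ≤ m𝓣.comap T₂)
    {A : Set Ω} (hA : MeasurableSet[m𝓣.comap T₂] A) {l : Ω' → 𝓣} (hl : Measurable l)
    (hlA : ∀ ω ∈ A, T₂ ω = l (T₁ ω)) {f : Ω → ℝ} (hf : Integrable f P) :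
    ∀ᵐ ω ∂P, ω ∈ A → ((P[|A])[f | mΩ'.comap T₁]) ω = (P[f | m𝓣.comap T₂]) ω := by
  have hAm := h12 A hA
  obtain ⟨g, hg, hgT⟩ := (stronglyMeasurable_condExp (μ := P) (f := f)
    (m := m𝓣.comap T₂)).exists_eq_measurable_comp
  have hgi : Integrable (P[f | m𝓣.comap T₂]) P := integrable_condExp
  have key : P[f | m𝓣.comap T₂] =ᵐ[P[|A]] (P[|A])[f | mΩ'.comap T₁] := by
    refine ae_eq_condExp_of_forall_setIntegral_eq (h.trans h12) hf.integrableOn.integrable_cond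
      (fun s _ _ => hgi.integrableOn.integrable_cond.integrableOn) ?_ ?_
    · intro s hs _
      have hs' := h s hs
      simp only [ProbabilityTheory.cond, Measure.restrict_smul,
        Measure.restrict_restrict (h12 s hs'), integral_smul_measure]
      rw [setIntegral_condExp h12 hf (hs'.inter hA)]
    -- On A the function g ∘ T₂ equals g ∘ l ∘ T₁, so under P[|A] it has a version measurable for
    -- the coarser σ-algebra.
    · refine ⟨fun ω => g (l (T₁ ω)),
        (hg.comp_measurable hl).comp_measurable (comap_measurable T₁), ?_⟩
      filter_upwards [ae_cond_mem hAm] with ω hω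
      rw [hgT, Function.comp_apply, hlA ω hω]
  rw [← ae_restrict_iff' hAm, restrict_eq_smul_cond]
  filter_upwards [Measure.ae_smul_measure key (P A)] with ω hω using hω.symm

/-- Under almost every measure of the regular conditional kernel, `f` and `g` are independent in the
ordinary sense, so the mean of the product of `f` and an indicator of `g` factors. -/
theorem condExp_indicator_ae_eq_mul_of_condIndepFun [StandardBorelSpace Ω]
    {hm : m ≤ mΩ} {μ : Measure Ω} [IsFiniteMeasure μ] {f g : Ω → ℝ}
    (h : CondIndepFun m hm f g μ) (hf : Integrable f μ) (hfm : Measurable f) (hg : Measurable g)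
    {t : Set ℝ} (ht : MeasurableSet t) :
    μ[(g ⁻¹' t).indicator f | m] =ᵐ[μ]
      μ[f | m] * μ[(g ⁻¹' t).indicator (fun _ => (1 : ℝ)) | m] := by
  have h' := ae_of_ae_trim hm ((condIndepFun_iff_map_prod_eq_prod_map_map hfm hg).1 h)
  have hgt := hg ht
  filter_upwards [h', condExp_ae_eq_integral_condExpKernel hm hf,
    condExp_ae_eq_integral_condExpKernel hm (hf.indicator hgt),
    condExp_ae_eq_integral_condExpKernel hm ((integrable_const (1 : ℝ)).indicator hgt)]
    with ω h h1 h2 h3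
  rw [Pi.mul_apply, h1, h2, h3]
  rw [Kernel.map_apply _ (hfm.prodMk hg), Kernel.prod_apply, Kernel.map_apply _ hfm,
    Kernel.map_apply _ hg,
    ← indepFun_iff_map_prod_eq_prod_map_map hfm.aemeasurable hg.aemeasurable] at h
  have h4 := (h.comp measurable_id (measurable_const.indicator ht :
    Measurable (t.indicator fun _ => (1 : ℝ)))).integral_fun_mul_eq_mul_integral
      hfm.aestronglyMeasurable ((measurable_const.indicator ht).comp hg).aestronglyMeasurable
  have h5 : (g ⁻¹' t).indicator f =
      fun x => (id ∘ f) x * ((t.indicator fun _ => (1 : ℝ)) ∘ g) x := by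
    ext x
    by_cases hx : g x ∈ t <;> simp [hx]
  rw [h5]
  exact h4

/-- On a product space, let `T` be a random variable that on `A × Ω'` does not depend on the first
coordinate, and let `F` be a product there. -/
theorem condExp_prod_eq_of_slice {ρ : Measure Ω} [IsProbabilityMeasure ρ] {ν : Measure Ω'}
    [IsProbabilityMeasure ν] {T : Ω × Ω' → 𝓣} (hT : Measurable T) {A : Set Ω}
    (hA : MeasurableSet[m𝓣.comap T] (A ×ˢ (Set.univ : Set Ω'))) (hAm : MeasurableSet A) {x₀ : Ω}
    (hTA : ∀ x ∈ A, ∀ e, T (x, e) = T (x₀, e)) {F : Ω × Ω' → ℝ} {φ : Ω → ℝ} {ψ : Ω' → ℝ}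
    (hψ : Integrable ψ ν) (hFi : Integrable F (ρ.prod ν))
    (hF : ∀ x ∈ A, ∀ e, F (x, e) = φ x * ψ e) :
    ∀ᵐ ω ∂(ρ.prod ν), ω.1 ∈ A → ((ρ.prod ν)[F | m𝓣.comap T]) ω =
      (ρ.real A)⁻¹ * (∫ x in A, φ x ∂ρ) * (ν[ψ | m𝓣.comap fun e => T (x₀, e)]) ω.2 := by
  have hT₀ : Measurable fun e => T (x₀, e) := hT.comp measurable_prodMk_left
  obtain ⟨g, hg, hgT⟩ := (stronglyMeasurable_condExp (μ := ν) (f := ψ)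
    (m := m𝓣.comap fun e => T (x₀, e))).exists_eq_measurable_comp
  have hgi : Integrable (fun e => g (T (x₀, e))) ν := by
    have : Integrable (ν[ψ | m𝓣.comap fun e => T (x₀, e)]) ν := integrable_condExp
    rwa [hgT] at this
  rw [hgT]
  set A' := A ×ˢ (Set.univ : Set Ω') with hA'
  set c := (ρ.real A)⁻¹ * (∫ x in A, φ x ∂ρ) with hc
  have hA'm : MeasurableSet A' := hT.comap_le A' hA
  have hG : A'.indicator (fun ω => c * g (T ω)) =
      fun ω : Ω × Ω' => A.indicator (fun _ => c) ω.1 * g (T (x₀, ω.2)) := by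
    ext ⟨x, e⟩
    by_cases hx : x ∈ A
    · simp [hA', hx, hTA x hx e]
    · simp [hA', hx]
  have hGi : Integrable (A'.indicator (fun ω => c * g (T ω))) (ρ.prod ν) := by
    -- After cutting off to A the function is a product of one factor in each coordinate, so its
    -- integrability follows from that of the factors.
    rw [hG]
    exact ((integrable_const c).indicator hAm).mul_prod hgi
  have key : A'.indicator (fun ω => c * g (T ω)) =ᵐ[ρ.prod ν]
      (ρ.prod ν)[A'.indicator F | m𝓣.comap T] := by
    refine ae_eq_condExp_of_forall_setIntegral_eq hT.comap_le (hFi.indicator hA'm)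
      (fun _ _ _ => hGi.integrableOn) ?_ ?_
    · rintro s ⟨t, ht, rfl⟩ -
      have hst : T ⁻¹' t ∩ A' = A ×ˢ ((fun e => T (x₀, e)) ⁻¹' t) := by
        ext ⟨x, e⟩
        simp only [hA', Set.mem_inter_iff, Set.mem_preimage, Set.mem_prod, Set.mem_univ, and_true]
        constructor
        · rintro ⟨h1, h2⟩; exact ⟨h2, hTA x h2 e ▸ h1⟩
        · rintro ⟨h1, h2⟩; exact ⟨(hTA x h1 e).symm ▸ h2, h1⟩
      have hm' := hAm.prod (hT₀ ht)
      rw [setIntegral_indicator hA'm, setIntegral_indicator hA'm, hst,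
        setIntegral_congr_fun (g := fun ω : Ω × Ω' => c * g (T (x₀, ω.2))) hm'
          (fun ω hω => by simp only [hTA ω.1 hω.1 ω.2]),
        setIntegral_congr_fun (g := fun ω : Ω × Ω' => φ ω.1 * ψ ω.2) hm'
          (fun ω hω => hF ω.1 hω.1 ω.2),
        setIntegral_prod_mul (fun _ => c) (fun e => g (T (x₀, e))), setIntegral_prod_mul φ ψ]
      have h1 : ∫ e in (fun e => T (x₀, e)) ⁻¹' t, g (T (x₀, e)) ∂ν =
          ∫ e in (fun e => T (x₀, e)) ⁻¹' t, ψ e ∂ν := by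
        rw [← setIntegral_condExp hT₀.comap_le hψ ⟨t, ht, rfl⟩, hgT]
        rfl
      rw [h1, setIntegral_const, smul_eq_mul, hc]
      -- The inverse in c is 0 for a null slice, but then both integrals over A vanish.
      by_cases h0 : ρ.real A = 0
      · have : ρ A = 0 := (measureReal_eq_zero_iff).1 h0
        rw [Measure.restrict_eq_zero.2 this]
        simp
      · rw [← mul_assoc, mul_inv_cancel₀ h0, one_mul]
    · exact (((hg.comp_measurable (comap_measurable T)).const_mul c).indicator
        hA).aestronglyMeasurable
  filter_upwards [key, condExp_indicator hFi hA] with ω h1 h2 hω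
  have hωA : ω ∈ A' := ⟨hω, trivial⟩
  rw [h2, Set.indicator_of_mem hωA, Set.indicator_of_mem hωA] at h1
  rw [← h1, Function.comp_apply, ← hTA ω.1 hω ω.2]

/-- On the slice the first coordinate is distributed as ρ given A, independently of the noise that
determines `T` and `F`. Each of the three conditional expectations is therefore a design factor (ρ(A
∩ B)/ρ(A) or 1) times a noise factor, and the product rule can be read off. -/
theorem condExp_prod_indicator_eq_mul_of_slice {ρ : Measure Ω} [IsProbabilityMeasure ρ]
    {ν : Measure Ω'} [IsProbabilityMeasure ν] {T : Ω × Ω' → 𝓣} (hT : Measurable T) {A : Set Ω}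
    (hA : MeasurableSet[m𝓣.comap T] (A ×ˢ (Set.univ : Set Ω'))) (hAm : MeasurableSet A) {x₀ : Ω}
    (hTA : ∀ x ∈ A, ∀ e, T (x, e) = T (x₀, e)) {F : Ω × Ω' → ℝ}
    (hFi : Integrable F (ρ.prod ν)) (hF : ∀ x ∈ A, ∀ e, F (x, e) = F (x₀, e))
    {B : Set Ω} (hB : MeasurableSet B) :
    ∀ᵐ ω ∂(ρ.prod ν), ω.1 ∈ A →
      ((ρ.prod ν)[(Prod.fst ⁻¹' B).indicator F | m𝓣.comap T]) ω =
      ((ρ.prod ν)[F | m𝓣.comap T]) ω *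
      ((ρ.prod ν)[(Prod.fst ⁻¹' B).indicator (fun _ => (1 : ℝ)) | m𝓣.comap T]) ω := by
  by_cases h0 : ρ A = 0
  · have : ∀ᵐ ω ∂(ρ.prod ν), ω.1 ∉ A :=
      Measure.quasiMeasurePreserving_fst.ae (measure_eq_zero_iff_ae_notMem.1 h0)
    filter_upwards [this] with ω h1 h2 using absurd h2 h1
  have hr : ρ.real A ≠ 0 := fun h => h0 ((measureReal_eq_zero_iff).1 h)
  have hψ : Integrable (fun e => F (x₀, e)) ν := by
    -- Fubini gives integrability of almost every section only; A has positive mass, so it contains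
    -- a good x, and all sections over A coincide.
    obtain ⟨x, hx, hxi⟩ : ∃ x ∈ A, Integrable (fun e => F (x, e)) ν := by
      by_contra! hcon
      refine h0 (measure_eq_zero_iff_ae_notMem.2 ?_)
      filter_upwards [hFi.prod_right_ae] with x h1 h2 using hcon x h2 h1
    simpa only [hF x hx] using hxi
  have hBm : MeasurableSet (Prod.fst ⁻¹' B : Set (Ω × Ω')) := measurable_fst hB
  filter_upwards [condExp_prod_eq_of_slice (φ := B.indicator fun _ => 1) hT hA hAm hTA hψ
      (hFi.indicator hBm)
      (fun x hx e => by by_cases hxB : x ∈ B <;> simp [hxB, hF x hx e]),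
    condExp_prod_eq_of_slice (φ := fun _ => 1) hT hA hAm hTA hψ hFi
      (fun x hx e => by rw [hF x hx e, one_mul]),
    condExp_prod_eq_of_slice (φ := B.indicator fun _ => 1) hT hA hAm hTA (integrable_const (1 : ℝ))
      ((integrable_const (1 : ℝ)).indicator hBm)
      (fun x hx e => by by_cases hxB : x ∈ B <;> simp [hxB])] with ω h1 h2 h3 hω
  have hT₀ : Measurable fun e => T (x₀, e) := hT.comp measurable_prodMk_left
  rw [h1 hω, h2 hω, h3 hω, condExp_const hT₀.comap_le, setIntegral_const, smul_eq_mul, mul_one,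
    inv_mul_cancel₀ hr]
  ring

end MeasureTheory

/-! ### Interventions in the structural equations -/

namespace NetCausal

variable {S : Schema} {V : Type}

theorem level_injective : Function.Injective level := by
  intro a b h
  cases a <;> cases b <;> simp_all [level]

theorem doValue_of_attr_ne {v : GVar S V} (hv : v.attr ≠ S.X) (x : V → Option Bool) :
    doValue x v = none := by
  simp [doValue, hv]

theorem doValue_treatment (x : V → Option Bool) (j : V) :
    doValue x (⟨S.X, .inl j, S.cls_X.symm⟩ : GVar S V) = (x j).map level := by
  simp [doValue]

/-- A treatment vertex of the ground graph is the treatment of some node. -/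
theorem GVar.eq_treatment {v : GVar S V} (hv : v.attr = S.X) :
    ∃ j : V, v = ⟨S.X, .inl j, S.cls_X.symm⟩ := by
  obtain ⟨a, it, h⟩ := v
  obtain rfl : a = S.X := hv
  cases it with
  | inl j => exact ⟨j, rfl⟩
  | inr e => rw [S.cls_X] at h; cases h

theorem GroundEdge.classEdge {D : Set (Dependency S)} {u v : GVar S V} (h : GroundEdge V D u v) :
    ClassEdge D u.attr v.attr := by
  obtain ⟨d, hd, h1, h2, -⟩ := h
  exact ⟨d, hd, h1, h2⟩

namespace NSCM

variable (M : NSCM S V)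

/-- Interventions on treatments do not affect attributes that do not descend from treatment. -/
theorem solve_eq_of_not_desc (x x' : V → Option Bool) (e : GVar S V → ℝ) (v : GVar S V)
    (hv : v.attr ≠ S.X) (hd : ¬ Relation.TransGen (ClassEdge M.D) S.X v.attr) :
    M.solve x e v = M.solve x' e v := by
  induction v using M.wf.induction with
  | _ v ih =>
    rw [M.solve_eq x, M.solve_eq x', doValue_of_attr_ne hv, doValue_of_attr_ne hv]
    have : (fun u : {u : GVar S V // GroundEdge V M.D u v} => M.solve x e u.1) =
        fun u => M.solve x' e u.1 := by
      funext u
      -- A parent that is a treatment, or descends from treatment, would make v a descendant of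
      -- treatment.
      refine ih u.1 u.2 (fun h => hd ?_) (fun h => hd (h.tail u.2.classEdge))
      have hu := u.2.classEdge
      rw [h] at hu
      exact .single hu
    simp only [this]

/-- Treatments of different nodes do not affect each other. -/
theorem solve_treatment_eq (x x' : V → Option Bool) (e : GVar S V → ℝ) (j : V) (hj : x j = x' j) :
    M.solve x e ⟨S.X, .inl j, S.cls_X.symm⟩ = M.solve x' e ⟨S.X, .inl j, S.cls_X.symm⟩ := by
  rw [M.solve_eq x, M.solve_eq x', doValue_treatment, doValue_treatment, hj]
  cases x' j with
  | some b => rfl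
  | none =>
    have : (fun u : {u : GVar S V // GroundEdge V M.D u ⟨S.X, .inl j, S.cls_X.symm⟩} =>
        M.solve x e u.1) = fun u => M.solve x' e u.1 := by
      funext u
      have hu : ClassEdge M.D u.1.attr S.X := u.2.classEdge
      -- By acyclicity of the class graph, no parent of a treatment is a treatment or descends from
      -- one.
      exact M.solve_eq_of_not_desc x x' e u.1
        (fun h => by rw [h] at hu; exact M.acyclic S.X (.single hu))
        (fun h => M.acyclic S.X (h.tail hu))
    simp only [Option.map_none, this]

theorem solve_treatment_of_some {x : V → Option Bool} {j : V} {b : Bool} (h : x j = some b)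
    (e : GVar S V → ℝ) : M.solve x e ⟨S.X, .inl j, S.cls_X.symm⟩ = level b := by
  rw [M.solve_eq, doValue_treatment, h]
  rfl

/-- Consistency: setting treatments to the values that they have anyway changes nothing. -/
theorem solve_consistent {x x' : V → Option Bool} {e : GVar S V → ℝ}
    (h : ∀ j, x' j = x j ∨ ∃ b, x' j = some b ∧
      M.solve x e ⟨S.X, .inl j, S.cls_X.symm⟩ = level b) :
    M.solve x' e = M.solve x e := by
  funext v
  induction v using M.wf.induction with
  | _ v ih =>
    have hpa : (fun u : {u : GVar S V // GroundEdge V M.D u v} => M.solve x' e u.1) =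
        fun u => M.solve x e u.1 := funext fun u => ih u.1 u.2
    by_cases hv : v.attr = S.X
    · obtain ⟨j, rfl⟩ := GVar.eq_treatment hv
      rcases h j with hj | ⟨b, hb, hs⟩
      · rw [M.solve_eq x', M.solve_eq x, doValue_treatment, doValue_treatment, hj, hpa]
      · rw [hs, M.solve_treatment_of_some hb]
    · rw [M.solve_eq x', M.solve_eq x, doValue_of_attr_ne hv, doValue_of_attr_ne hv, hpa]

end NSCM

/-! ### The maximal adjustment set -/

/-- The set is squeezed: selection variables force in every context, while measurability and the
exclusion of outcomes leave room only for treatments. -/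
theorem IsAdjustmentSet.eq_maximalSet {W : Set (RelVar S)} (hW : IsAdjustmentSet W)
    (hsel : S.selection = S.background) : W = maximalSet S := by
  ext r
  constructor
  · intro hr
    by_cases hX : r.attr = S.X
    · left
      obtain ⟨n, a, h⟩ := r
      obtain rfl : a = S.X := hX
      have hX' := S.cls_X
      -- Treatment is a node attribute, so only paths of 0 or 2 steps can end in it: the node's own
      -- treatment, which is excluded, and the peers'.
      fin_cases n
      · exact absurd hr hW.own_notMem
      · rw [hX'] at h; cases h
      · rfl
      · rw [hX'] at h; cases h
    · exact Or.inr ⟨hW.measured r hr, hX, hW.outcome_notMem r hr⟩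
  · rintro (rfl | hr)
    · exact hW.peer_mem
    · exact hW.selection_subset r (hsel ▸ hr)

/-- The skeleton is the complete graph: any other node shares a pair with i, so it is reached in
exactly two steps, while bridge burning excludes i itself. -/
theorem inl_mem_terminal_two {i j : V} : (.inl j : Item V) ∈ terminal (.inl i) 2 ↔ j ≠ i := by
  constructor
  · rintro ⟨-, h⟩ rfl
    exact h (Or.inl rfl)
  · intro hji
    have hd : ¬ (s(i, j) : Sym2 V).IsDiag := by simpa using hji.symm
    refine ⟨Or.inr ⟨.inr ⟨s(i, j), hd⟩, Or.inr ⟨.inl i, rfl, ?_⟩, ?_⟩, ?_⟩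
    · exact Sym2.mem_mk_left i j
    · exact Sym2.mem_mk_right i j
    · rintro (h | ⟨y, rfl, h⟩)
      · exact hji (Sum.inl.inj h)
      · exact h

theorem treatment_mem_ground_maximalSet {i j : V} (hj : j ≠ i) :
    (⟨S.X, .inl j, S.cls_X.symm⟩ : GVar S V) ∈ ground (maximalSet S) i :=
  ⟨peerTreatment S, Or.inl rfl, rfl, inl_mem_terminal_two.2 hj⟩

theorem mem_ground_maximalSet {i : V} {v : GVar S V} (hv : v ∈ ground (maximalSet S) i) :
    (∃ j, j ≠ i ∧ v = ⟨S.X, .inl j, S.cls_X.symm⟩) ∨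
      v ∈ ground (contexts S) i ∧ v.attr ∈ S.background := by
  obtain ⟨r, rfl | hr, h1, h2⟩ := hv
  · obtain ⟨j, rfl⟩ := GVar.eq_treatment h1.symm
    exact Or.inl ⟨j, inl_mem_terminal_two.1 h2, rfl⟩
  · exact Or.inr ⟨⟨r, hr, h1, h2⟩, h1 ▸ hr⟩

/-! ### Projections of a data record to relational variables -/

namespace Record

/-- The part of a data record that consists of the relational variables in `W` for node `i`. -/
def proj (W : Set (RelVar S)) (i : V) (o : Record S V)
    (v : {v : {v : GVar S V // v.attr ∉ S.latent} // v.1 ∈ ground W i}) : ℝ := o v.1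

theorem measurable_proj (W : Set (RelVar S)) (i : V) :
    Measurable (proj W i : Record S V → _) :=
  measurable_pi_iff.2 fun v => measurable_pi_apply v.1

theorem measurable_treatment (j : V) : Measurable fun o : Record S V => o.treatment j :=
  measurable_pi_apply _

theorem measurable_outcome (j : V) : Measurable fun o : Record S V => o.outcome j :=
  measurable_pi_apply _

theorem sigma_le (W : Set (RelVar S)) (i : V) :
    (sigma W i : MeasurableSpace (Record S V)) ≤ MeasurableSpace.pi :=
  (measurable_proj W i).comap_le

theorem measurableSet_treatment (j : V) (b : Bool) :
    MeasurableSet {o : Record S V | o.treatment j = level b} :=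
  measurable_treatment j (measurableSet_singleton _)

theorem measurableSet_peerTreatment [Finite V] (i : V) (π : V → Bool) :
    MeasurableSet[sigma (maximalSet S) i]
      {o : Record S V | ∀ j, j ≠ i → o.treatment j = level (π j)} := by
  simp only [Set.ofPred_forall]
  refine MeasurableSet.iInter fun j => MeasurableSet.iInter fun hj => ?_
  refine ⟨{p | p ⟨⟨⟨S.X, .inl j, S.cls_X.symm⟩, S.X_observed⟩, treatment_mem_ground_maximalSet hj⟩
    = level (π j)}, measurable_pi_apply _ (measurableSet_singleton _), rfl⟩

theorem proj_maximalSet_congr {i : V} {o o' : Record S V}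
    (ht : ∀ j, j ≠ i → o.treatment j = o'.treatment j)
    (hb : ∀ v, v.1.attr ∈ S.background → o v = o' v) :
    proj (maximalSet S) i o = proj (maximalSet S) i o' := by
  funext ⟨⟨v, hvm⟩, hv⟩
  rcases mem_ground_maximalSet hv with ⟨j, hj, rfl⟩ | ⟨-, h⟩
  · exact ht j hj
  · exact hb _ h

open Classical in
/-- Completes the contexts by given peer treatments. -/
noncomputable def fillPeers (i : V) (π : V → Bool)
    (p : {v : {v : GVar S V // v.attr ∉ S.latent} // v.1 ∈ ground (contexts S) i} → ℝ)
    (v : {v : {v : GVar S V // v.attr ∉ S.latent} // v.1 ∈ ground (maximalSet S) i}) : ℝ :=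
  if h : v.1.1 ∈ ground (contexts S) i then p ⟨v.1, h⟩
  else match v.1.1.item with
    | .inl j => level (π j)
    -- A dummy value: the only variables of the maximal set outside the contexts are treatments of
    -- nodes.
    | .inr _ => 0

theorem measurable_fillPeers (i : V) (π : V → Bool) :
    Measurable (fillPeers (S := S) i π) := by
  refine measurable_pi_iff.2 fun v => ?_
  unfold fillPeers
  by_cases h : v.1.1 ∈ ground (contexts S) i
  · simp only [h, dite_true]
    exact measurable_pi_apply _
  · simp only [h, dite_false]
    exact measurable_const

/-- Once the peer treatments are known to be π, the contexts carry all the information of the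
maximal set; this is what allows the two conditionings in the direct effect to be exchanged. -/
theorem proj_maximalSet_eq_fillPeers {i : V} {π : V → Bool} {o : Record S V}
    (ho : ∀ j, j ≠ i → o.treatment j = level (π j)) :
    proj (maximalSet S) i o = fillPeers i π (proj (contexts S) i o) := by
  funext ⟨⟨v, hvm⟩, hv⟩
  by_cases h : v ∈ ground (contexts S) i
  · simp [fillPeers, h, proj]
  · rcases mem_ground_maximalSet hv with ⟨j, hj, rfl⟩ | ⟨h', -⟩
    · simp only [fillPeers, h, dite_false]
      exact ho j hj
    · exact absurd h' h

end Record

/-! ### Identification from consistency and the product rule -/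

namespace Regime

theorem sigma_eq_comap (R : Regime S V) (W : Set (RelVar S)) (i : V) :
    R.sigma W i = MeasurableSpace.comap (fun ω => Record.proj W i (R.record ω)) inferInstance :=
  MeasurableSpace.comap_comp

theorem sigma_contexts_le (R : Regime S V) (i : V) :
    R.sigma (contexts S) i ≤ R.sigma (maximalSet S) i := by
  refine MeasurableSpace.comap_mono ?_
  let sub (v : {v : {v : GVar S V // v.attr ∉ S.latent} // v.1 ∈ ground (contexts S) i}) :
      {v : {v : GVar S V // v.attr ∉ S.latent} // v.1 ∈ ground (maximalSet S) i} :=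
    ⟨v.1, v.2.imp fun _ h => ⟨Or.inr h.1, h.2⟩⟩
  have h : (Record.proj (contexts S) i : Record S V → _) =
      (fun p v => p (sub v)) ∘ Record.proj (maximalSet S) i := rfl
  have hm : Measurable fun (p : {v : {v : GVar S V // v.attr ∉ S.latent} //
      v.1 ∈ ground (maximalSet S) i} → ℝ) v => p (sub v) :=
    measurable_pi_iff.2 fun v => measurable_pi_apply (sub v)
  change MeasurableSpace.comap (Record.proj (contexts S) i) _ ≤
    MeasurableSpace.comap (Record.proj (maximalSet S) i) _
  rw [h, ← MeasurableSpace.comap_comp]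
  exact MeasurableSpace.comap_mono hm.comap_le

variable [DecidableEq V]

/-- Identification in a regime with consistent counterfactuals, in which the counterfactual outcomes
are conditionally uncorrelated with the node's own treatment given the maximal adjustment set. -/
theorem identification [Finite V] (R : Regime S V) [IsFiniteMeasure R.P] (i : V)
    (hrec : Measurable R.record) (hY : ∀ b, Integrable (R.counterfactual i b) R.P)
    (hcons : ∀ b ω, (R.record ω).treatment i = level b →
      R.counterfactual i b ω = (R.record ω).outcome i)
    (hjoint : ∀ b (π : V → Bool) ω, (∀ j, j ≠ i → (R.record ω).treatment j = level (π j)) →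
      R.jointCounterfactual i b π ω = R.counterfactual i b ω)
    (hmul : ∀ b, R.P[(R.record ⁻¹' {o | o.treatment i = level b}).indicator (R.counterfactual i b)
        | R.sigma (maximalSet S) i] =ᵐ[R.P]
      R.P[R.counterfactual i b | R.sigma (maximalSet S) i] *
      R.P[(R.record ⁻¹' {o | o.treatment i = level b}).indicator (fun _ => (1 : ℝ))
        | R.sigma (maximalSet S) i]) :
    (∀ b, ∀ᵐ ω ∂(R.P), 0 < propensity R.law i b (R.record ω) →
      (R.P[R.counterfactual i b | R.sigma (maximalSet S) i]) ω =
        regression R.law i b (R.record ω)) ∧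
    (∀ π : V → Bool, ∀ᵐ ω ∂(R.P),
      (∀ j, j ≠ i → (R.record ω).treatment j = level (π j)) →
      (∀ b, 0 < propensity R.law i b (R.record ω)) →
      R.directEffect i π ω =
        regression R.law i true (R.record ω) - regression R.law i false (R.record ω)) := by
  have h1 : ∀ b, ∀ᵐ ω ∂(R.P), 0 < propensity R.law i b (R.record ω) →
      (R.P[R.counterfactual i b | R.sigma (maximalSet S) i]) ω =
        regression R.law i b (R.record ω) := fun b =>
    condExp_eq_cond_condExp_of_condExp_mul hrec (Record.sigma_le _ i)
      (Record.measurableSet_treatment i b) (Record.measurable_outcome i) (hY b)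
      (hcons b) (hmul b)
  refine ⟨h1, fun π => ?_⟩
  set A := {ω | ∀ j, j ≠ i → (R.record ω).treatment j = level (π j)} with hA
  have hle : R.sigma (maximalSet S) i ≤ R.mΩ :=
    (MeasurableSpace.comap_mono (Record.sigma_le _ i)).trans hrec.comap_le
  have hAm : MeasurableSet[R.sigma (maximalSet S) i] A :=
    ⟨_, Record.measurableSet_peerTreatment i π, rfl⟩
  have h2 : ∀ᵐ ω ∂(R.P), ω ∈ A →
      ((R.P[|A])[R.counterfactual i true - R.counterfactual i false | R.sigma (contexts S) i]) ω =
      (R.P[R.counterfactual i true - R.counterfactual i false | R.sigma (maximalSet S) i]) ω := by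
    have hc := R.sigma_contexts_le i
    rw [sigma_eq_comap] at hAm hle
    rw [sigma_eq_comap, sigma_eq_comap] at hc ⊢
    exact cond_condExp_ae_eq_of_comap hle hc hAm (Record.measurable_fillPeers i π)
      (fun ω hω => Record.proj_maximalSet_eq_fillPeers hω) ((hY true).sub (hY false))
  have h3 : R.directEffect i π =ᵐ[R.P[|A]]
      (R.P[|A])[R.counterfactual i true - R.counterfactual i false | R.sigma (contexts S) i] := by
    refine condExp_congr_ae ?_
    filter_upwards [ae_cond_mem (hle A hAm)] with ω hω
    rw [hjoint true π ω hω, hjoint false π ω hω, Pi.sub_apply]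
  have h3' : ∀ᵐ ω ∂(R.P), ω ∈ A → R.directEffect i π ω =
      ((R.P[|A])[R.counterfactual i true - R.counterfactual i false
        | R.sigma (contexts S) i]) ω := by
    -- Almost sure statements under P[|A] become almost sure statements under P on A; this also
    -- covers a null event A.
    rw [← ae_restrict_iff' (hle A hAm), restrict_eq_smul_cond]
    exact Measure.ae_smul_measure h3 (R.P A)
  filter_upwards [h1 true, h1 false, h2, h3', condExp_sub (hY true) (hY false)
    (R.sigma (maximalSet S) i)] with ω ht hf h2 h3 h4 hω hpos
  rw [h3 hω, h2 hω, h4, Pi.sub_apply, ht (hpos true), hf (hpos false)]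

end Regime

/-! ### Verification for observational and experimental data -/

namespace NSCM

variable (M : NSCM S V)

theorem observational_identification [Finite V] [DecidableEq V] (i : V)
    (hY : ∀ b, Integrable (M.observational.counterfactual i b) M.observational.P)
    (hM : M.Unconfounded i (maximalSet S)) :
    (∀ b, ∀ᵐ ω ∂M.observational.P, 0 < propensity M.observational.law i b
        (M.observational.record ω) →
      (M.observational.P[M.observational.counterfactual i b
        | M.observational.sigma (maximalSet S) i]) ω =
        regression M.observational.law i b (M.observational.record ω)) ∧
    (∀ π : V → Bool, ∀ᵐ ω ∂M.observational.P,
      (∀ j, j ≠ i → (M.observational.record ω).treatment j = level (π j)) →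
      (∀ b, 0 < propensity M.observational.law i b (M.observational.record ω)) →
      M.observational.directEffect i π ω =
        regression M.observational.law i true (M.observational.record ω) -
          regression M.observational.law i false (M.observational.record ω)) := by
  refine M.observational.identification i M.measurable_record hY ?_ ?_ ?_
  · intro b ω h
    refine congrFun (M.solve_consistent fun j => ?_) _
    by_cases hj : j = i
    · subst hj
      exact Or.inr ⟨b, if_pos rfl, h⟩
    · exact Or.inl (if_neg hj)
  · intro b π ω h
    refine congrFun (M.solve_consistent fun j => ?_) _
    by_cases hj : j = i
    · exact Or.inl (by simp [hj])
    -- Consistency is applied to the world with X_i = b, where peer treatments must already equal π.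
    -- They do so in the factual world, and setting X_i leaves them unchanged.
    · refine Or.inr ⟨π j, if_neg hj, (M.solve_treatment_eq _ _ ω j ?_).trans (h j hj)⟩
      exact if_neg hj
  · intro b
    have hm : ∀ b, Measurable (M.observational.counterfactual i b) := fun b =>
      (measurable_pi_apply _).comp (M.measurable_solve _)
    have h : CondIndepFun (M.observational.sigma (maximalSet S) i) (M.sigma_le _ i)
        (M.observational.counterfactual i b)
        (fun ω => (M.observational.record ω).treatment i) M.observational.P := by
      -- Only the marginal conditional independence of each potential outcome is needed, a
      -- coordinate of the pair.
      cases b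
      · exact CondIndepFun.comp hM measurable_snd measurable_id
      · exact CondIndepFun.comp hM measurable_fst measurable_id
    exact condExp_indicator_ae_eq_mul_of_condIndepFun h (hY b) (hm b)
      ((Record.measurable_treatment i).comp M.measurable_record)
      (measurableSet_singleton (level b))

theorem measurable_experimental_record [Finite V] (ρ : Measure (V → Bool)) :
    Measurable (M.experimental ρ).record := by
  refine measurable_from_prod_countable_right fun x => ?_
  exact measurable_pi_iff.2 fun v =>
    (measurable_pi_apply v.1).comp (M.measurable_solve fun j => some (x j))

theorem experimental_record_treatment (ρ : Measure (V → Bool)) (ω : (V → Bool) × (GVar S V → ℝ))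
    (j : V) : ((M.experimental ρ).record ω).treatment j = level (ω.1 j) :=
  M.solve_treatment_of_some rfl ω.2

/-- Randomization replaces unconfoundedness. The design may correlate treatments, so the product
rule is proved separately on each slice of fixed peer assignment; that contexts do not react to the
node's own treatment is where the pre-treatment assumption enters. -/
theorem experimental_identification [Finite V] [DecidableEq V] (hA1 : M.PreTreatment) (i : V)
    (ρ : Measure (V → Bool)) [IsProbabilityMeasure ρ]
    (hY : ∀ b, Integrable ((M.experimental ρ).counterfactual i b) (M.experimental ρ).P) :
    (∀ b, ∀ᵐ ω ∂(M.experimental ρ).P, 0 < propensity (M.experimental ρ).law i b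
        ((M.experimental ρ).record ω) →
      ((M.experimental ρ).P[(M.experimental ρ).counterfactual i b
        | (M.experimental ρ).sigma (maximalSet S) i]) ω =
        regression (M.experimental ρ).law i b ((M.experimental ρ).record ω)) ∧
    (∀ π : V → Bool, ∀ᵐ ω ∂(M.experimental ρ).P,
      (∀ j, j ≠ i → ((M.experimental ρ).record ω).treatment j = level (π j)) →
      (∀ b, 0 < propensity (M.experimental ρ).law i b ((M.experimental ρ).record ω)) →
      (M.experimental ρ).directEffect i π ω =
        regression (M.experimental ρ).law i true ((M.experimental ρ).record ω) -
          regression (M.experimental ρ).law i false ((M.experimental ρ).record ω)) := by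
  have hrec := M.measurable_experimental_record ρ
  have : IsFiniteMeasure (M.experimental ρ).P :=
    inferInstanceAs (IsFiniteMeasure (ρ.prod M.noise))
  refine (M.experimental ρ).identification i hrec hY ?_ ?_ ?_
  · intro b ω h
    have hb := level_injective ((M.experimental_record_treatment ρ ω i).symm.trans h)
    have hx : (fun j => some ((if j = i then some b else none : Option Bool).getD (ω.1 j))) =
        fun j => some ((none : Option Bool).getD (ω.1 j)) := by
      funext j
      by_cases hj : j = i
      · simp [hj, hb]
      · simp [hj]
    exact congrArg (fun x => M.solve x ω.2 ⟨S.Y, .inl i, S.cls_Y.symm⟩) hx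
  · intro b π ω h
    have hx : (fun j => some ((if j = i then some b else some (π j) : Option Bool).getD (ω.1 j))) =
        fun j => some ((if j = i then some b else none : Option Bool).getD (ω.1 j)) := by
      funext j
      by_cases hj : j = i
      · simp [hj]
      · have := level_injective ((M.experimental_record_treatment ρ ω j).symm.trans (h j hj))
        simp [hj, this]
    exact congrArg (fun x => M.solve x ω.2 ⟨S.Y, .inl i, S.cls_Y.symm⟩) hx
  · intro b
    have hB : (M.experimental ρ).record ⁻¹' {o | o.treatment i = level b} =
        Prod.fst ⁻¹' {x : V → Bool | x i = b} := by
      ext ω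
      exact (Eq.congr_left (M.experimental_record_treatment ρ ω i)).trans level_injective.eq_iff
    have hslice : ∀ x₀ : V → Bool, ∀ᵐ ω ∂(ρ.prod M.noise), ω.1 ∈ {x | ∀ j, j ≠ i → x j = x₀ j} →
        ((ρ.prod M.noise)[(Prod.fst ⁻¹' {x : V → Bool | x i = b}).indicator
          ((M.experimental ρ).counterfactual i b) | (M.experimental ρ).sigma (maximalSet S) i]) ω =
        ((ρ.prod M.noise)[(M.experimental ρ).counterfactual i b
          | (M.experimental ρ).sigma (maximalSet S) i]) ω *
        ((ρ.prod M.noise)[(Prod.fst ⁻¹' {x : V → Bool | x i = b}).indicator (fun _ => (1 : ℝ))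
          | (M.experimental ρ).sigma (maximalSet S) i]) ω := by
      intro x₀
      have hA : MeasurableSet[(M.experimental ρ).sigma (maximalSet S) i]
          ({x : V → Bool | ∀ j, j ≠ i → x j = x₀ j} ×ˢ (Set.univ : Set (GVar S V → ℝ))) := by
        refine ⟨_, Record.measurableSet_peerTreatment i x₀, ?_⟩
        ext ω
        refine Iff.trans (forall₂_congr fun j _ => ?_) (and_iff_left trivial).symm
        exact (Eq.congr_left (M.experimental_record_treatment ρ ω j)).trans level_injective.eq_iff
      rw [Regime.sigma_eq_comap] at hA ⊢
      refine condExp_prod_indicator_eq_mul_of_slice (x₀ := x₀)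
        ((Record.measurable_proj _ i).comp hrec) hA (Set.toFinite _).measurableSet ?_ (hY b) ?_
        (Set.toFinite _).measurableSet
      · intro x hx e
        refine Record.proj_maximalSet_congr (fun j hj => ?_) (fun v hv => ?_)
        · rw [experimental_record_treatment, experimental_record_treatment]
          exact congrArg level (hx j hj)
        · exact M.solve_eq_of_not_desc _ _ e v.1 hv.2.1 (hA1.not_desc_X _ hv)
      · intro x hx e
        have hx' : (fun j => some ((if j = i then some b else none : Option Bool).getD (x j))) =
            fun j => some ((if j = i then some b else none : Option Bool).getD (x₀ j)) := by
          funext j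
          by_cases hj : j = i
          · simp [hj]
          · simp [hj, hx j hj]
        exact congrArg (fun x => M.solve x e ⟨S.Y, .inl i, S.cls_Y.symm⟩) hx'
    rw [hB]
    -- There are finitely many assignments, so the exceptional null sets can be united; every ω lies
    -- in the slice of its own assignment.
    filter_upwards [ae_all_iff.2 hslice] with ω hω
    exact hω ω.1 fun _ _ => rfl

end NSCM

end NetCausal

theorem mainTheorem4 (S : Schema) (V : Type) [Finite V] [DecidableEq V] (M : NSCM S V)
    (hA1 : M.PreTreatment) (i : V) (R : Regime S V)
    (hR : (∃ ρ : Measure (V → Bool), IsProbabilityMeasure ρ ∧ R = M.experimental ρ) ∨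
      (R = M.observational ∧ ∃ W : Set (RelVar S), IsAdjustmentSet W ∧ M.Unconfounded i W))
    (hY : ∀ b, Integrable (R.counterfactual i b) R.P) :
    (∀ b, ∀ᵐ ω ∂(R.P), 0 < propensity R.law i b (R.record ω) →
      (R.P[R.counterfactual i b | R.sigma (maximalSet S) i]) ω =
        regression R.law i b (R.record ω)) ∧
    (∀ π : V → Bool, ∀ᵐ ω ∂(R.P),
      (∀ j, j ≠ i → (R.record ω).treatment j = level (π j)) →
      (∀ b, 0 < propensity R.law i b (R.record ω)) →
      R.directEffect i π ω =
        regression R.law i true (R.record ω) - regression R.law i false (R.record ω)) := by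
  rcases hR with ⟨ρ, hρ, rfl⟩ | ⟨rfl, W, hW, hM⟩
  · exact M.experimental_identification hA1 i ρ hY
  · exact M.observational_identification i hY (hW.eq_maximalSet hA1.selection_eq ▸ hM)
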